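/- Let $K$ be a field of characteristic $0$ and $R = K[X_1,\dots,X_n]$, graded by $\deg X_i = \omega_i$ with positive integers $\omega_i$; put $\omega = \sum_{i=1}^n \omega_i$ and $\partial_i = \partial/\partial X_i$, $\deg \partial_i = -\omega_i$. Let $I$ be a graded ideal of $R$. For $p \ge 0$ let $N = H^p_I(R)$ be the $p$-th local cohomology module of $R$ with support in $I$, i.e. the $p$-th cohomology of the Čech complex $$0 \to R \to \bigoplus_i R_{f_i} \to \bigoplus_{i<j} R_{f_if_j} \to \cdots \to R_{f_1\cdots f_s} \to 0$$ for any homogeneous generators $f_1,\dots,f_s$ of $I$, with the grading and with the action of $\partial_1,\dots,\partial_n$ induced from the localizations of $R$ (where $\partial_i$ acts by the quotient rule). For $q \ge 0$ let $H^q(\partial_1,\dots,\partial_n; N)$ be the $q$-th De Rham cohomology of $N$, i.e. the $q$-th cohomology of the complex with $\bigoplus_{|T| = q} N\,dX_T$ ($T \subseteq \{1,\dots,n\}$) in degree $q$ and differential $m\,dX_T \mapsto \sum_{t} \partial_t(m)\,dX_t\wedge dX_T$, graded as the Koszul complex $0 \to N(\omega) \to \cdots \to \bigoplus_i N(\omega_i)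 \to N \to 0$, i.e. the summand $N\,dX_T$ is $N(\sum_{i\notin T}\omega_i)$, where $N(l)_j = N_{l+j}$. Then for all $p, q \ge 0$ the graded $K$-vector space $H^q(\partial_1,\dots,\partial_n; H^p_I(R))$ is concentrated in degree $-\omega$: $$H^q(\partial_1,\dots,\partial_n; H^p_I(R))_j = 0 \ \text{ for all } j \ne -\omega, \qquad H^q(\partial_1,\dots,\partial_n; H^p_I(R)) = H^q(\partial_1,\dots,\partial_n; H^p_I(R))_{-\omega}.$$ -/

import Mathlib

open scoped BigOperators

noncomputable section

/-! ### Cubical (Koszul type) complexes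

For a family of `K`-modules `A S`, indexed by the subsets `S` of `{0, …, m-1}`, and linear maps
`φ T t : A (T \ {t}) → A T`, the complex has `∏_{|S| = p} A S` in degree `p` and the differential
`(d ξ)_T = ∑_{t ∈ T} (-1)^{#{u ∈ T, u < t}} φ T t (ξ_{T \ {t}})`.  All degrees are put together in
the one module `∏_S A S`. -/
section Cube

variable {K : Type*} [Field K] {m : ℕ} {A : Finset (Fin m) → Type*}
  [∀ S, AddCommGroup (A S)] [∀ S, Module K (A S)]

/-- The differential of the cubical complex. -/
def cubeD (φ : ∀ (T : Finset (Fin m)) (t : Fin m), A (T.erase t) →ₗ[K] A T) :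
    (∀ S, A S) →ₗ[K] (∀ S, A S) :=
  LinearMap.pi fun T => ∑ t ∈ T,
    ((-1 : K) ^ (T.filter (fun u => u < t)).card) •
      ((φ T t) ∘ₗ (LinearMap.proj (T.erase t) : (∀ S, A S) →ₗ[K] A (T.erase t)))

variable (K A) in
/-- The families `ξ` with `ξ_S = 0` unless `S` satisfies `P`. -/
def cubeSupp (P : Finset (Fin m) → Prop) : Submodule K (∀ S, A S) where
  carrier := {ξ | ∀ S, ¬ P S → ξ S = 0}
  add_mem' {x y} hx hy S hS := by simp [hx S hS, hy S hS]
  zero_mem' _ _ := rfl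
  smul_mem' c x hx S hS := by simp [hx S hS]

/-- The cocycles of degree `p`. -/
def cubeCocycles (φ : ∀ (T : Finset (Fin m)) (t : Fin m), A (T.erase t) →ₗ[K] A T) (p : ℕ) :
    Submodule K (∀ S, A S) :=
  cubeSupp K A (fun S => S.card = p) ⊓ LinearMap.ker (cubeD φ)

/-- The coboundaries of degree `p`: the images of the cochains of degree `p - 1`
(so this is `0` for `p = 0`). -/
def cubeCoboundaries (φ : ∀ (T : Finset (Fin m)) (t : Fin m), A (T.erase t) →ₗ[K] A T) (p : ℕ) :
    Submodule K (∀ S, A S) :=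
  (cubeSupp K A (fun S => S.card + 1 = p)).map (cubeD φ)

/-- The `p`-th cohomology of the cubical complex: cocycles modulo coboundaries. -/
abbrev CubeCohomology (φ : ∀ (T : Finset (Fin m)) (t : Fin m), A (T.erase t) →ₗ[K] A T) (p : ℕ) :
    Type _ :=
  (cubeCocycles φ p) ⧸ (cubeCoboundaries φ p).submoduleOf (cubeCocycles φ p)

/-- If `B S ⊆ A S` are the homogeneous parts of some fixed degree of the entries of the complex,
this is the part of that degree of the cohomology: the classes of the homogeneous cocycles. -/
def cubeCohomologyPart (φ : ∀ (T : Finset (Fin m)) (t : Fin m), A (T.erase t) →ₗ[K] A T) (p : ℕ)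
    (B : ∀ S, Submodule K (A S)) : Submodule K (CubeCohomology φ p) :=
  ((Submodule.pi Set.univ B).comap (cubeCocycles φ p).subtype).map
    ((cubeCoboundaries φ p).submoduleOf (cubeCocycles φ p)).mkQ

theorem cubeD_piMap (φ : ∀ (T : Finset (Fin m)) (t : Fin m), A (T.erase t) →ₗ[K] A T)
    (ψ : ∀ S, A S →ₗ[K] A S)
    (h : ∀ T t x, φ T t (ψ (T.erase t) x) = ψ T (φ T t x)) (ξ : ∀ S, A S) :
    cubeD φ (LinearMap.piMap ψ ξ) = LinearMap.piMap ψ (cubeD φ ξ) := by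
  funext T
  simp [cubeD, h]

theorem piMap_mem_cubeSupp (ψ : ∀ S, A S →ₗ[K] A S) (P : Finset (Fin m) → Prop)
    {ξ : ∀ S, A S} (hξ : ξ ∈ cubeSupp K A P) : LinearMap.piMap ψ ξ ∈ cubeSupp K A P := by
  intro S hS
  simp [hξ S hS]

theorem piMap_mem_cubeCocycles
    (φ : ∀ (T : Finset (Fin m)) (t : Fin m), A (T.erase t) →ₗ[K] A T)
    (ψ : ∀ S, A S →ₗ[K] A S)
    (h : ∀ T t x, φ T t (ψ (T.erase t) x) = ψ T (φ T t x)) (p : ℕ)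
    (ξ : ∀ S, A S) (hξ : ξ ∈ cubeCocycles φ p) :
    LinearMap.piMap ψ ξ ∈ cubeCocycles φ p := by
  refine ⟨piMap_mem_cubeSupp ψ _ hξ.1, ?_⟩
  have h0 : cubeD φ ξ = 0 := hξ.2
  change cubeD φ (LinearMap.piMap ψ ξ) = 0
  rw [cubeD_piMap φ ψ h, h0, map_zero]

/-- A family of maps `ψ S : A S → A S` that commutes with the maps `φ` acts on the cohomology. -/
def cubeCohomologyMap (φ : ∀ (T : Finset (Fin m)) (t : Fin m), A (T.erase t) →ₗ[K] A T)
    (ψ : ∀ S, A S →ₗ[K] A S)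
    (h : ∀ T t x, φ T t (ψ (T.erase t) x) = ψ T (φ T t x)) (p : ℕ) :
    CubeCohomology φ p →ₗ[K] CubeCohomology φ p :=
  Submodule.mapQ _ _
    ((LinearMap.piMap ψ).restrict (piMap_mem_cubeCocycles φ ψ h p)) (by
      rintro ⟨x, hx⟩ ⟨y, hy, hyx⟩
      refine ⟨LinearMap.piMap ψ y, piMap_mem_cubeSupp ψ _ hy, ?_⟩
      rw [cubeD_piMap φ ψ h, hyx]
      rfl)

end Cube

/-! ### The extension of a derivation to a localization -/
section Localization

variable {K : Type*} [Field K] {R : Type*} [CommRing R] [Algebra K R]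

/-- The extension of a derivation `D` of `R` to a localization of `R`, by the quotient rule
`D (a / b) = (b D(a) - a D(b)) / b²`. -/
def localizationDer (D : Derivation K R R) (M : Submonoid R) :
    Localization M →ₗ[K] Localization M where
  toFun z := Localization.liftOn z
    (fun a b => Localization.mk ((b : R) * D a - a * D (b : R)) (b * b)) (by
      intro a c b d h
      rw [Localization.r_iff_exists] at h
      obtain ⟨u, hu⟩ := h
      have hD := congrArg D hu
      simp only [Derivation.leibniz, smul_eq_mul] at hD
      rw [Localization.mk_eq_mk_iff, Localization.r_iff_exists]
      refine ⟨u * u, ?_⟩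
      push_cast
      linear_combination ((u : R) * b * d) * hD - ((b : R) * d * D (u : R)) * hu
        - ((u : R) * d * D (b : R)) * hu - ((u : R) * b * D (d : R)) * hu)
  map_add' x y := by
    induction x, y using Localization.induction_on₂ with
    | H x y =>
      obtain ⟨a, b⟩ := x
      obtain ⟨c, d⟩ := y
      rw [Localization.add_mk]
      simp only [Localization.liftOn_mk]
      rw [Localization.add_mk, Localization.mk_eq_mk_iff, Localization.r_iff_exists]
      refine ⟨1, ?_⟩
      simp only [Derivation.leibniz, smul_eq_mul, map_add, Submonoid.coe_mul, OneMemClass.coe_one]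
      ring
  map_smul' k x := by
    induction x using Localization.induction_on with
    | H x =>
      obtain ⟨a, b⟩ := x
      simp only [Localization.smul_mk, Localization.liftOn_mk, RingHom.id_apply]
      congr 1
      rw [D.map_smul, mul_smul_comm, smul_mul_assoc, smul_sub]

/-- The canonical map `M⁻¹R → N⁻¹R` for `M ⊆ N`. -/
def localizationMap (K : Type*) [Field K] {R : Type*} [CommRing R] [Algebra K R]
    {M N : Submonoid R} (h : M ≤ N) : Localization M →ₐ[K] Localization N :=
  { IsLocalization.lift (M := M) (S := Localization M) (g := algebraMap R (Localization N))
      (fun y => IsLocalization.map_units (Localization N) ⟨(y : R), h y.2⟩) with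
    commutes' := fun k => by
      change IsLocalization.lift _ (algebraMap K (Localization M) k) = _
      rw [IsScalarTower.algebraMap_apply K R (Localization M), IsLocalization.lift_eq,
        ← IsScalarTower.algebraMap_apply K R (Localization N)] }

theorem localizationMap_mk {M N : Submonoid R} (h : M ≤ N) (a : R) (b : M) :
    localizationMap K h (Localization.mk a b) = Localization.mk a ⟨(b : R), h b.2⟩ := by
  change IsLocalization.lift (M := M) (S := Localization M) (g := algebraMap R (Localization N)) _
    (Localization.mk a b) = _
  rw [Localization.mk_eq_mk', IsLocalization.lift_mk'_spec, Localization.mk_eq_mk',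
    ← IsLocalization.mk'_spec' (Localization N) a ⟨(b : R), h b.2⟩]

theorem localizationMap_der (D : Derivation K R R) {M N : Submonoid R} (h : M ≤ N)
    (z : Localization M) :
    localizationMap K h (localizationDer D M z) = localizationDer D N (localizationMap K h z) := by
  induction z using Localization.induction_on with
  | H x =>
    obtain ⟨a, b⟩ := x
    rw [localizationMap_mk]
    simp only [localizationDer, LinearMap.coe_mk, AddHom.coe_mk, Localization.liftOn_mk]
    rw [localizationMap_mk]
    rfl

end Localization

/-! ### Local cohomology with its action of derivations, through the Čech complex -/
section LocalCohomology

variable {K : Type*} [Field K] {R : Type*} [CommRing R] [Algebra K R] {s : ℕ}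

/-- The localization of `R` at the elements `f j`, `j ∈ S`, i.e. `R_{f_{j₁} ⋯ f_{jₚ}}` for
`S = {j₁, …, jₚ}`. -/
abbrev CechLocalization (f : Fin s → R) (S : Finset (Fin s)) : Type _ :=
  Localization (Submonoid.closure (f '' (S : Set (Fin s))))

theorem closure_image_erase_le (f : Fin s → R) (T : Finset (Fin s)) (t : Fin s) :
    Submonoid.closure (f '' ((T.erase t : Finset (Fin s)) : Set (Fin s))) ≤
      Submonoid.closure (f '' (T : Set (Fin s))) :=
  Submonoid.closure_mono (Set.image_mono (Finset.coe_subset.2 (Finset.erase_subset t T)))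

variable (K) in
/-- The localization map `R_{∏ f_j, j ∈ T \ {t}} → R_{∏ f_j, j ∈ T}`. -/
def cechMap (f : Fin s → R) (T : Finset (Fin s)) (t : Fin s) :
    CechLocalization f (T.erase t) →ₗ[K] CechLocalization f T :=
  (localizationMap K (closure_image_erase_le f T t)).toLinearMap

variable (K) in
/-- The local cohomology `H^p_I(R)` with support in the ideal `I = (f₁, …, f_s)`: the `p`-th
cohomology of the Čech complex `0 → R → ∏ R_{f_i} → ∏ R_{f_i f_j} → ⋯ → R_{f₁ ⋯ f_s} → 0`. -/
abbrev LocalCohomology (f : Fin s → R) (p : ℕ) : Type _ :=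
  CubeCohomology (cechMap K f) p

/-- The action of a derivation of `R` on the local cohomology `H^p_I(R)`, induced by its action on
the localizations of `R`. -/
def localCohomologyDer (f : Fin s → R) (p : ℕ) (D : Derivation K R R) :
    LocalCohomology K f p →ₗ[K] LocalCohomology K f p :=
  cubeCohomologyMap (cechMap K f) (fun _ => localizationDer D _)
    (fun T t x => localizationMap_der D (closure_image_erase_le f T t) x) p

end LocalCohomology

/-! ### The grading of local cohomology over a weighted polynomial ring -/
section Grading

variable {K : Type*} [Field K] {n : ℕ}

open MvPolynomial

/-- The elements of degree `d` of a localization `M⁻¹ K[X₁, …, Xₙ]`, where `deg X_i = w i`: the span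
of the fractions `a / b` with `a`, `b` homogeneous and `deg a - deg b = d`. -/
def localizationDegree (w : Fin n → ℕ) (M : Submonoid (MvPolynomial (Fin n) K)) (d : ℤ) :
    Submodule K (Localization M) :=
  Submodule.span K {z | ∃ (a : MvPolynomial (Fin n) K) (b : M) (k l : ℕ),
    IsWeightedHomogeneous w a k ∧ IsWeightedHomogeneous w (b : MvPolynomial (Fin n) K) l ∧
      (k : ℤ) - l = d ∧ z = Localization.mk a b}

/-- The part of degree `d` of the local cohomology `H^p_I(R)`, for `I = (f₁, …, f_s)` with
homogeneous `f_j`. -/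
def localCohomologyDegree (w : Fin n → ℕ) {s : ℕ} (f : Fin s → MvPolynomial (Fin n) K) (p : ℕ)
    (d : ℤ) : Submodule K (LocalCohomology K f p) :=
  cubeCohomologyPart (cechMap K f) p (fun _ => localizationDegree w _ d)

end Grading

/-! ### De Rham cohomology -/
section DeRham

variable {K : Type*} [Field K] {n : ℕ} {N : Type*} [AddCommGroup N] [Module K N]

/-- The `q`-th De Rham cohomology `H^q(∂₁, …, ∂ₙ; N)` of a `K`-vector space `N` with operators
`∂ i` (which commute in the cases of interest): the cohomology of the complex with
`∏_{|T| = q} N` in degree `q`, where `N` in the factor `T` stands for `N dX_T`, and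
with differential `(d ξ)_T = ∑_{t ∈ T} ± ∂_t (ξ_{T \ {t}})`. -/
abbrev DeRhamCohomology (del : Fin n → N →ₗ[K] N) (q : ℕ) : Type _ :=
  CubeCohomology (A := fun _ : Finset (Fin n) => N) (fun _ t => del t) q

/-- The part of degree `j` of `H^q(∂₁, …, ∂ₙ; N)`, for a grading `𝒩` of `N` such that `∂ i` has
degree `-w i`.  The complex is graded as the Koszul complex
`0 → N(ω₁ + ⋯ + ωₙ) → ⋯ → ⨁ N(ω_i) → N → 0`, so that all differentials have degree `0`: the factor
`T` is `N(∑_{i ∉ T} w i)`, where `N(l)_j = N_{l + j}`. -/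
def deRhamDegree (w : Fin n → ℕ) (del : Fin n → N →ₗ[K] N) (𝒩 : ℤ → Submodule K N) (q : ℕ)
    (j : ℤ) : Submodule K (DeRhamCohomology del q) :=
  cubeCohomologyPart (A := fun _ : Finset (Fin n) => N) (fun _ t => del t) q
    (fun T => 𝒩 (j + ∑ i ∈ Tᶜ, (w i : ℤ)))

end DeRham

end

attribute [local instance] MvPolynomial.weightedGradedAlgebra

/-! The Euler field `E = ∑ w i X i ∂ᵢ` acts on the degree `d` part of `N = H^p_I(R)` as the scalar
`d`. On a form `z dX_T` its Lie derivative is `E z + (∑_{t ∈ T} w t) z`. In De Rham degree `j` the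
coefficient `z` has degree `j + ∑_{i ∉ T} w i`, so the Lie derivative acts there as the scalar `j +
ω`, whatever `T` is. By `cartan_formula` it equals `dι + ιd`, with `ι` the contraction with `E`, so
it is nullhomotopic. In characteristic `0` the scalar is invertible for `j ≠ -ω`, hence that part of
the cohomology vanishes (`cubeCohomologyPart_eq_bot_of_cartan`).

It remains to see that the homogeneous classes span, so that the part of degree `-ω` is everything.
`iSup_cubeCohomologyPart` gives this, once for the Čech complex with `E` and once for the De Rham
complex with the Lie derivative: homogeneous components of a cocycle are cocycles, because
eigenspaces for distinct eigenvalues are independent. -/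

open MvPolynomial in
/-- The Euler derivation `∑ i, w i • X i ∂ᵢ` of a weighted polynomial ring. -/
noncomputable def eulerDer (K : Type*) [Field K] {n : ℕ} (w : Fin n → ℕ) :
    Derivation K (MvPolynomial (Fin n) K) (MvPolynomial (Fin n) K) :=
  ∑ i, w i • (X i : MvPolynomial (Fin n) K) • pderiv i

/-! ### Homogeneous classes in the cohomology of a cubical complex. -/

section Cube

variable {K : Type*} [Field K] {m : ℕ} {A : Finset (Fin m) → Type*}
  [∀ S, AddCommGroup (A S)] [∀ S, Module K (A S)]

theorem cubeD_apply (φ : ∀ (T : Finset (Fin m)) (t : Fin m), A (T.erase t) →ₗ[K] A T)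
    (ξ : ∀ S, A S) (T : Finset (Fin m)) :
    cubeD φ ξ T =
      ∑ t ∈ T, ((-1 : K) ^ (T.filter (fun u => u < t)).card) • φ T t (ξ (T.erase t)) := by
  simp [cubeD]

/-- If the homogeneous parts span the entries of the complex and are contained in eigenspaces, for
distinct eigenvalues, of an operator that commutes with the differential, then the homogeneous
parts span the cohomology. -/
theorem iSup_cubeCohomologyPart
    (φ : ∀ (T : Finset (Fin m)) (t : Fin m), A (T.erase t) →ₗ[K] A T)
    (ψ : ∀ S, A S →ₗ[K] A S)
    (hφ : ∀ T, ∀ t ∈ T, ∀ x, φ T t (ψ (T.erase t) x) = ψ T (φ T t x))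
    (B : ℤ → ∀ S, Submodule K (A S)) (c : ℤ → K) (hc : Function.Injective c)
    (hB : ∀ d S, ∀ x ∈ B d S, ψ S x = c d • x) (htop : ∀ S, ⨆ d, B d S = ⊤) (p : ℕ) :
    ⨆ d, cubeCohomologyPart φ p (B d) = ⊤ := by
  classical
  rw [eq_top_iff]
  rintro z -
  obtain ⟨⟨ξ, hξp, hξ⟩, rfl⟩ := Submodule.Quotient.mk_surjective _ z
  have hdec : ∀ S, ∃ g : ℤ →₀ A S, (∀ d, g d ∈ B d S) ∧ g.sum (fun _ x => x) = ξ S := fun S =>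
    (Submodule.mem_iSup_iff_exists_finsupp _ _).1 (htop S ▸ Submodule.mem_top)
  choose g hg hgs using hdec
  let J : Finset ℤ := Finset.univ.biUnion fun S => (g S).support
  -- The cut-off is needed: off degree `p` the chosen components only sum to `0` and need not
  -- vanish.
  let η : ℤ → ∀ S, A S := fun d S => if S.card = p then g S d else 0
  have hsum : ∑ d ∈ J, η d = ξ := by
    funext S
    rw [Finset.sum_apply]
    by_cases hS : S.card = p
    · simp only [η, if_pos hS]
      rw [← hgs S, Finsupp.sum]
      refine (Finset.sum_subset (Finset.subset_biUnion_of_mem (fun S => (g S).support)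
        (Finset.mem_univ S)) fun d _ hd => ?_).symm
      simpa using hd
    · simp only [η, if_neg hS, Finset.sum_const_zero]
      exact (hξp S hS).symm
  have hηB : ∀ d S, η d S ∈ B d S := fun d S => by
    by_cases hS : S.card = p
    · simpa only [η, if_pos hS] using hg S d
    · simp only [η, if_neg hS, zero_mem]
  have hηD : ∀ d, cubeD φ (η d) ∈ Module.End.eigenspace (LinearMap.piMap ψ) (c d) := fun d => by
    rw [Module.End.mem_eigenspace_iff]
    funext T
    change ψ T (cubeD φ (η d) T) = c d • cubeD φ (η d) T
    rw [cubeD_apply, map_sum, Finset.smul_sum]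
    refine Finset.sum_congr rfl fun t ht => ?_
    rw [map_smul, ← hφ T t ht, hB d _ _ (hηB d _), map_smul, smul_comm]
  -- The elements `cubeD φ (η d)` lie in independent eigenspaces and sum to `cubeD φ ξ = 0`, so each
  -- is `0`.
  have hindep := (Module.End.eigenspaces_iSupIndep
    (LinearMap.piMap ψ : Module.End K (∀ S, A S))).comp hc
  have hzero : ∀ d ∈ J, cubeD φ (η d) = 0 :=
    (iSupIndep_iff_finsetSum_eq_zero_imp_eq_zero _).1 hindep J (fun d => cubeD φ (η d))
      (fun d _ => hηD d) (by rw [← map_sum, hsum]; exact hξ)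
  have hmem : ∀ d ∈ J, η d ∈ cubeCocycles φ p := fun d hd =>
    ⟨fun S hS => if_neg hS, hzero d hd⟩
  have hξsum : (⟨ξ, hξp, hξ⟩ : cubeCocycles φ p) =
      ∑ d ∈ J.attach, ⟨η d, hmem d d.2⟩ := by
    apply Subtype.ext
    rw [AddSubmonoidClass.coe_finsetSum, Finset.sum_attach J η, hsum]
  rw [hξsum, ← Submodule.mkQ_apply, map_sum]
  refine Submodule.sum_mem _ fun d _ => Submodule.mem_iSup_of_mem (d : ℤ) ?_
  exact Submodule.mem_map_of_mem fun S _ => hηB d S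

theorem cubeCohomologyMap_mk
    (φ : ∀ (T : Finset (Fin m)) (t : Fin m), A (T.erase t) →ₗ[K] A T)
    (ψ : ∀ S, A S →ₗ[K] A S)
    (h : ∀ T t x, φ T t (ψ (T.erase t) x) = ψ T (φ T t x)) (p : ℕ) (ξ : cubeCocycles φ p) :
    cubeCohomologyMap φ ψ h p (Submodule.Quotient.mk ξ) =
      Submodule.Quotient.mk ⟨LinearMap.piMap ψ ξ, piMap_mem_cubeCocycles φ ψ h p ξ ξ.2⟩ :=
  rfl

theorem cubeCohomologyMap_of_mem_part
    (φ : ∀ (T : Finset (Fin m)) (t : Fin m), A (T.erase t) →ₗ[K] A T)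
    (ψ : ∀ S, A S →ₗ[K] A S)
    (h : ∀ T t x, φ T t (ψ (T.erase t) x) = ψ T (φ T t x)) (p : ℕ)
    (B : ∀ S, Submodule K (A S)) (c : K) (hB : ∀ S, ∀ x ∈ B S, ψ S x = c • x)
    {z : CubeCohomology φ p} (hz : z ∈ cubeCohomologyPart φ p B) :
    cubeCohomologyMap φ ψ h p z = c • z := by
  obtain ⟨ξ, hξ, rfl⟩ := hz
  rw [Submodule.mkQ_apply, cubeCohomologyMap_mk, ← Submodule.Quotient.mk_smul]
  congr 1
  apply Subtype.ext
  funext S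
  exact hB S _ (hξ S (Set.mem_univ S))

end Cube

/-! ### Calculus of derivations on a localization. -/

section Localization

variable {K : Type*} [Field K] {R : Type*} [CommRing R] [Algebra K R]

theorem localizationDer_mk (D : Derivation K R R) (M : Submonoid R) (a : R) (b : M) :
    localizationDer D M (Localization.mk a b) =
      Localization.mk ((b : R) * D a - a * D (b : R)) (b * b) :=
  rfl

theorem Localization.algebraMap_mul_mk {M : Submonoid R} (r a : R) (b : M) :
    algebraMap R (Localization M) r * Localization.mk a b = Localization.mk (r * a) b := by
  rw [← Localization.mk_one_eq_algebraMap, Localization.mk_mul, one_mul]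

theorem localizationDer_algebraMap_mul (D : Derivation K R R) (M : Submonoid R) (r : R)
    (z : Localization M) :
    localizationDer D M (algebraMap R _ r * z) =
      algebraMap R _ (D r) * z + algebraMap R _ r * localizationDer D M z := by
  induction z using Localization.induction_on with
  | H x =>
    obtain ⟨a, b⟩ := x
    rw [localizationDer_mk, Localization.algebraMap_mul_mk, Localization.algebraMap_mul_mk,
      Localization.algebraMap_mul_mk, localizationDer_mk, Localization.add_mk,
      Localization.mk_eq_mk_iff, Localization.r_iff_exists]
    refine ⟨1, ?_⟩
    simp only [Derivation.leibniz, smul_eq_mul, Submonoid.coe_mul, OneMemClass.coe_one]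
    ring

theorem localizationDer_add (D E : Derivation K R R) (M : Submonoid R) :
    localizationDer (D + E) M = localizationDer D M + localizationDer E M := by
  ext z
  induction z using Localization.induction_on with
  | H x =>
    obtain ⟨a, b⟩ := x
    rw [LinearMap.add_apply, localizationDer_mk, localizationDer_mk, localizationDer_mk,
      Localization.add_mk_self]
    congr 1
    simp only [Derivation.add_apply]
    ring

theorem localizationDer_smul (r : R) (D : Derivation K R R) (M : Submonoid R)
    (z : Localization M) :
    localizationDer (r • D) M z = algebraMap R _ r * localizationDer D M z := by
  induction z using Localization.induction_on with
  | H x =>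
    obtain ⟨a, b⟩ := x
    rw [localizationDer_mk, localizationDer_mk, Localization.algebraMap_mul_mk]
    congr 1
    simp only [Derivation.smul_apply, smul_eq_mul]
    ring

theorem localizationDer_lie (D E : Derivation K R R) (M : Submonoid R) (z : Localization M) :
    localizationDer D M (localizationDer E M z) =
      localizationDer E M (localizationDer D M z) + localizationDer ⁅D, E⁆ M z := by
  induction z using Localization.induction_on with
  | H x =>
    obtain ⟨a, b⟩ := x
    simp only [localizationDer_mk]
    rw [Localization.add_mk, Localization.mk_eq_mk_iff, Localization.r_iff_exists]
    refine ⟨1, ?_⟩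
    simp only [Derivation.leibniz, smul_eq_mul, Submonoid.coe_mul, OneMemClass.coe_one, map_sub,
      Derivation.commutator_apply]
    ring

theorem localizationMap_algebraMap_mul {M N : Submonoid R} (h : M ≤ N) (r : R)
    (z : Localization M) :
    localizationMap K h (algebraMap R _ r * z) = algebraMap R _ r * localizationMap K h z := by
  rw [map_mul, ← Localization.mk_one_eq_algebraMap, ← Localization.mk_one_eq_algebraMap,
    localizationMap_mk]
  rfl

end Localization

/-! ### The Euler derivation on polynomials and their localizations. -/

section Euler

open MvPolynomial

variable {K : Type*} [Field K] {n : ℕ} (w : Fin n → ℕ)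

theorem eulerDer_apply (a : MvPolynomial (Fin n) K) :
    eulerDer K w a = ∑ i, w i • (X i * pderiv i a) := by
  rw [eulerDer, ← Derivation.coeFnAddMonoidHom_apply, map_sum, Finset.sum_apply]
  rfl

theorem eulerDer_of_isWeightedHomogeneous {a : MvPolynomial (Fin n) K} {k : ℕ}
    (ha : IsWeightedHomogeneous w a k) : eulerDer K w a = k • a := by
  rw [eulerDer_apply, ha.sum_weight_X_mul_pderiv]

/-- This expresses that `∂_t` lowers degrees by `w t`. Derivations of a polynomial ring are
determined by their values on the variables. -/
theorem lie_pderiv_eulerDer (t : Fin n) :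
    ⁅(pderiv t : Derivation K (MvPolynomial (Fin n) K) (MvPolynomial (Fin n) K)), eulerDer K w⁆ =
      (w t : K) • pderiv t := by
  classical
  refine MvPolynomial.derivation_ext fun i => ?_
  rw [Derivation.commutator_apply, eulerDer_of_isWeightedHomogeneous w
    (isWeightedHomogeneous_X K w i), map_nsmul, Derivation.smul_apply, pderiv_X]
  by_cases h : i = t
  · subst h
    rw [Pi.single_eq_same, Derivation.map_one_eq_zero, sub_zero, Nat.cast_smul_eq_nsmul]
  · rw [Pi.single_eq_of_ne h]
    simp

/-- For homogeneous `a`, `b` of degrees `k`, `l`, the quotient rule gives `(b · k a - a · l b) / b²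
= (k - l) a / b`. -/
theorem localizationDer_eulerDer_of_mem (M : Submonoid (MvPolynomial (Fin n) K)) (d : ℤ)
    {z : Localization M} (hz : z ∈ localizationDegree w M d) :
    localizationDer (eulerDer K w) M z = (d : K) • z := by
  induction hz using Submodule.span_induction with
  | mem z hz =>
    obtain ⟨a, b, k, l, ha, hb, rfl, rfl⟩ := hz
    rw [localizationDer_mk, eulerDer_of_isWeightedHomogeneous w ha,
      eulerDer_of_isWeightedHomogeneous w hb, Localization.smul_mk, Localization.mk_eq_mk_iff,
      Localization.r_iff_exists]
    refine ⟨1, ?_⟩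
    simp only [Submonoid.coe_mul, OneMemClass.coe_one, nsmul_eq_mul]
    simp only [Algebra.smul_def, Int.cast_sub, Int.cast_natCast, map_sub, map_natCast]
    ring
  | zero => simp
  | add x y _ _ hx hy => rw [map_add, hx, hy, smul_add]
  | smul c x _ hx => rw [map_smul, hx, smul_comm]

/-- Denominators are already homogeneous, so it suffices to split numerators into monomials. -/
theorem iSup_localizationDegree (M : Submonoid (MvPolynomial (Fin n) K))
    (hM : ∀ b ∈ M, ∃ l, IsWeightedHomogeneous w b l) :
    ⨆ d, localizationDegree w M d = ⊤ := by
  rw [eq_top_iff]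
  rintro z -
  induction z using Localization.induction_on with
  | H x =>
    obtain ⟨a, b⟩ := x
    obtain ⟨l, hl⟩ := hM b b.2
    rw [a.as_sum, Localization.mk_sum]
    refine Submodule.sum_mem _ fun v _ => Submodule.mem_iSup_of_mem
      (((Finsupp.weight w v : ℕ) : ℤ) - l) (Submodule.subset_span ?_)
    exact ⟨_, b, _, l, isWeightedHomogeneous_monomial w v _ rfl, hl, rfl, rfl⟩

theorem exists_isWeightedHomogeneous_of_mem_closure {S : Set (MvPolynomial (Fin n) K)}
    (hS : ∀ b ∈ S, ∃ l, IsWeightedHomogeneous w b l) :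
    ∀ b ∈ Submonoid.closure S, ∃ l, IsWeightedHomogeneous w b l := by
  intro b hb
  induction hb using Submonoid.closure_induction with
  | mem b hb => exact hS b hb
  | one => exact ⟨0, isWeightedHomogeneous_one K w⟩
  | mul x y _ _ hx hy =>
    obtain ⟨k, hk⟩ := hx
    obtain ⟨l, hl⟩ := hy
    exact ⟨k + l, hk.mul hl⟩

end Euler

/-! ### Operators on local cohomology, with identities checked on cocycles in each localization. -/

section LocalCohomology

variable {K : Type*} [Field K] {R : Type*} [CommRing R] [Algebra K R] {s : ℕ}

/-- Multiplication by an element of `R` on local cohomology. -/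
noncomputable def localCohomologyMul (f : Fin s → R) (p : ℕ) (r : R) :
    LocalCohomology K f p →ₗ[K] LocalCohomology K f p :=
  cubeCohomologyMap (cechMap K f) (fun _ => LinearMap.mulLeft K (algebraMap R _ r))
    (fun T t x => localizationMap_algebraMap_mul (K := K) (closure_image_erase_le f T t) r x) p

theorem localCohomologyDer_mul (f : Fin s → R) (p : ℕ) (D : Derivation K R R) (r : R)
    (z : LocalCohomology K f p) :
    localCohomologyDer f p D (localCohomologyMul f p r z) =
      localCohomologyMul f p (D r) z + localCohomologyMul f p r (localCohomologyDer f p D z) := by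
  obtain ⟨ξ, rfl⟩ := Submodule.Quotient.mk_surjective _ z
  refine congrArg Submodule.Quotient.mk (Subtype.ext (funext fun S => ?_))
  exact localizationDer_algebraMap_mul D _ r _

theorem localCohomologyMul_one (f : Fin s → R) (p : ℕ) (z : LocalCohomology K f p) :
    localCohomologyMul f p 1 z = z := by
  obtain ⟨ξ, rfl⟩ := Submodule.Quotient.mk_surjective _ z
  refine congrArg Submodule.Quotient.mk (Subtype.ext (funext fun S => ?_))
  simp

theorem localCohomologyMul_zero (f : Fin s → R) (p : ℕ) (z : LocalCohomology K f p) :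
    localCohomologyMul f p 0 z = 0 := by
  obtain ⟨ξ, rfl⟩ := Submodule.Quotient.mk_surjective _ z
  refine congrArg Submodule.Quotient.mk (Subtype.ext (funext fun S => ?_))
  simp

theorem localCohomologyDer_lie (f : Fin s → R) (p : ℕ) (D E : Derivation K R R)
    (z : LocalCohomology K f p) :
    localCohomologyDer f p D (localCohomologyDer f p E z) =
      localCohomologyDer f p E (localCohomologyDer f p D z) + localCohomologyDer f p ⁅D, E⁆ z := by
  obtain ⟨ξ, rfl⟩ := Submodule.Quotient.mk_surjective _ z
  refine congrArg Submodule.Quotient.mk (Subtype.ext (funext fun S => ?_))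
  exact localizationDer_lie D E _ _

theorem localCohomologyDer_smul (f : Fin s → R) (p : ℕ) (r : R) (D : Derivation K R R)
    (z : LocalCohomology K f p) :
    localCohomologyDer f p (r • D) z =
      localCohomologyMul f p r (localCohomologyDer f p D z) := by
  obtain ⟨ξ, rfl⟩ := Submodule.Quotient.mk_surjective _ z
  refine congrArg Submodule.Quotient.mk (Subtype.ext (funext fun S => ?_))
  exact localizationDer_smul r D _ _

theorem localCohomologyDer_add (f : Fin s → R) (p : ℕ) (D E : Derivation K R R)
    (z : LocalCohomology K f p) :
    localCohomologyDer f p (D + E) z =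
      localCohomologyDer f p D z + localCohomologyDer f p E z := by
  obtain ⟨ξ, rfl⟩ := Submodule.Quotient.mk_surjective _ z
  refine congrArg Submodule.Quotient.mk (Subtype.ext (funext fun S => ?_))
  exact LinearMap.congr_fun (localizationDer_add D E _) _

theorem localCohomologyMul_smul (f : Fin s → R) (p : ℕ) (c : K) (r : R)
    (z : LocalCohomology K f p) :
    localCohomologyMul f p (c • r) z = c • localCohomologyMul f p r z := by
  obtain ⟨ξ, rfl⟩ := Submodule.Quotient.mk_surjective _ z
  refine congrArg Submodule.Quotient.mk (Subtype.ext (funext fun S => ?_))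
  simp [Algebra.smul_def, ← IsScalarTower.algebraMap_apply]

/-- The action of derivations on local cohomology is `K`-linear in the derivation. -/
noncomputable def localCohomologyDerHom (f : Fin s → R) (p : ℕ) :
    Derivation K R R →ₗ[K] LocalCohomology K f p →ₗ[K] LocalCohomology K f p where
  toFun := localCohomologyDer f p
  map_add' D E := LinearMap.ext (localCohomologyDer_add f p D E)
  map_smul' c D := LinearMap.ext fun z => by
    -- The scalar `c` is treated as an element of `R`, which reduces to the rule for `r • D`.
    rw [← algebraMap_smul R c D, localCohomologyDer_smul, Algebra.algebraMap_eq_smul_one,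
      localCohomologyMul_smul, localCohomologyMul_one]
    rfl

end LocalCohomology

/-! ### The Euler operator on local cohomology. -/

section LocalCohomologyEuler

open MvPolynomial

variable {K : Type*} [Field K] {n : ℕ} (w : Fin n → ℕ) {s : ℕ}
  (f : Fin s → MvPolynomial (Fin n) K) (p : ℕ)

theorem localCohomologyDer_eulerDer_of_mem (d : ℤ) {z : LocalCohomology K f p}
    (hz : z ∈ localCohomologyDegree w f p d) :
    localCohomologyDer f p (eulerDer K w) z = (d : K) • z :=
  cubeCohomologyMap_of_mem_part _ _ _ p _ _
    (fun _ _ hx => localizationDer_eulerDer_of_mem w _ d hx) hz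

theorem iSup_localCohomologyDegree [CharZero K]
    (hf : ∀ j, ∃ d, IsWeightedHomogeneous w (f j) d) :
    ⨆ d, localCohomologyDegree w f p d = ⊤ := by
  refine iSup_cubeCohomologyPart (cechMap K f) (fun _ => localizationDer (eulerDer K w) _)
    (fun T t _ x => localizationMap_der _ (closure_image_erase_le f T t) x) _
    (fun d => (d : K)) Int.cast_injective
    (fun d S x hx => localizationDer_eulerDer_of_mem w _ d hx) (fun S => ?_) p
  refine iSup_localizationDegree w _ (exists_isWeightedHomogeneous_of_mem_closure w ?_)
  rintro _ ⟨j, _, rfl⟩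
  exact hf j

theorem localCohomologyDer_eulerDer (z : LocalCohomology K f p) :
    localCohomologyDer f p (eulerDer K w) z =
      ∑ i, (w i : K) • localCohomologyMul f p (X i) (localCohomologyDer f p (pderiv i) z) := by
  have h : localCohomologyDerHom f p (eulerDer K w) =
      ∑ i, (w i : K) • localCohomologyDerHom f p ((X i : MvPolynomial (Fin n) K) • pderiv i) := by
    rw [eulerDer, map_sum]
    exact Finset.sum_congr rfl fun i _ => by rw [map_nsmul, Nat.cast_smul_eq_nsmul]
  refine (LinearMap.congr_fun h z).trans ?_
  rw [LinearMap.sum_apply]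
  refine Finset.sum_congr rfl fun i _ => ?_
  rw [LinearMap.smul_apply]
  exact congrArg _ (localCohomologyDer_smul f p (X i) (pderiv i) z)

theorem localCohomologyDer_pderiv_eulerDer (t : Fin n) (z : LocalCohomology K f p) :
    localCohomologyDer f p (pderiv t) (localCohomologyDer f p (eulerDer K w) z) =
      localCohomologyDer f p (eulerDer K w) (localCohomologyDer f p (pderiv t) z) +
        (w t : K) • localCohomologyDer f p (pderiv t) z := by
  rw [localCohomologyDer_lie, lie_pderiv_eulerDer]
  congr 1
  exact LinearMap.congr_fun ((localCohomologyDerHom f p).map_smul (w t : K) (pderiv t)) z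

end LocalCohomologyEuler

/-! ### Cartan's formula and vanishing of De Rham cohomology. -/

section DeRham

variable {K : Type*} [Field K] {n : ℕ} {N : Type*} [AddCommGroup N] [Module K N]

/-- The contraction of differential forms with the vector field `∑ i, x i ∂ᵢ`. -/
noncomputable def deRhamContraction (x : Fin n → N →ₗ[K] N) (ξ : Finset (Fin n) → N) :
    Finset (Fin n) → N :=
  fun S => ∑ u ∈ Sᶜ, ((-1 : K) ^ (S.filter (fun v => v < u)).card) • x u (ξ (insert u S))

/-- Exactly one of the two counts changes when the other index is removed or inserted first: the one
for `u` if `t < u`, the one for `t` if `u < t`. This sign makes the mixed terms of `dι` and `ιd`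
cancel. -/
theorem neg_one_pow_card_filter_exchange {T : Finset (Fin n)} {t u : Fin n} (ht : t ∈ T)
    (hu : u ∉ T) :
    (-1 : K) ^ (T.filter (fun v => v < t)).card *
        (-1) ^ ((T.erase t).filter (fun v => v < u)).card =
      -((-1) ^ (T.filter (fun v => v < u)).card *
        (-1) ^ ((insert u T).filter (fun v => v < t)).card) := by
  rw [Finset.filter_erase, Finset.filter_insert]
  rcases lt_or_gt_of_ne (show t ≠ u from fun h => hu (h ▸ ht)) with h | h
  · rw [if_neg h.not_gt, ← Finset.card_erase_add_one
      (show t ∈ T.filter (fun v => v < u) from Finset.mem_filter.2 ⟨ht, h⟩)]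
    ring
  · rw [if_pos h, Finset.card_insert_of_notMem (fun h' => hu (Finset.mem_filter.1 h').1),
      Finset.erase_eq_of_notMem
        (show t ∉ T.filter (fun v => v < u) from fun h' => h.not_gt (Finset.mem_filter.1 h').2)]
    ring

/-- Cartan's formula for the Lie derivative of differential forms with coefficients in `N` with
respect to the vector field `∑ i, w i X i ∂ᵢ`. -/
theorem cartan_formula (del x : Fin n → N →ₗ[K] N) (c : Fin n → K)
    (hne : ∀ t u, t ≠ u → ∀ z, del t (x u z) = x u (del t z))
    (heq : ∀ t z, del t (x t z) = x t (del t z) + c t • z)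
    (ξ : Finset (Fin n) → N) (T : Finset (Fin n)) :
    cubeD (A := fun _ => N) (fun _ t => del t) (deRhamContraction x ξ) T +
        deRhamContraction x (cubeD (A := fun _ => N) (fun _ t => del t) ξ) T =
      ∑ i, x i (del i (ξ T)) + (∑ t ∈ T, c t) • ξ T := by
  classical
  -- After `t` is removed, the index put back is either `t` itself, which gives the diagonal term
  -- with the commutator `c t`, or some `u ∉ T`.
  have h1 : cubeD (A := fun _ => N) (fun _ t => del t) (deRhamContraction x ξ) T =
      ∑ t ∈ T, (x t (del t (ξ T)) + c t • ξ T) +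
      ∑ t ∈ T, ∑ u ∈ Tᶜ, ((-1 : K) ^ (T.filter (fun v => v < t)).card *
        (-1) ^ ((T.erase t).filter (fun v => v < u)).card) •
          x u (del t (ξ (insert u (T.erase t)))) := by
    rw [cubeD_apply, ← Finset.sum_add_distrib]
    refine Finset.sum_congr rfl fun t ht => ?_
    rw [deRhamContraction, Finset.compl_erase, Finset.sum_insert (by simpa using ht), map_add,
      smul_add, map_smul, smul_smul, Finset.insert_erase ht, heq, Finset.filter_erase,
      Finset.erase_eq_of_notMem (by simp), ← mul_pow, neg_one_mul, neg_neg, one_pow, one_smul,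
      map_sum, Finset.smul_sum]
    refine congrArg _ (Finset.sum_congr rfl fun u hu => ?_)
    rw [map_smul, smul_smul, hne t u fun h => Finset.mem_compl.1 hu (h ▸ ht),
      Finset.filter_erase]
  -- Dually, after `u ∉ T` is inserted, either `u` is removed again or some `t ∈ T` is.
  have h2 : deRhamContraction x (cubeD (A := fun _ => N) (fun _ t => del t) ξ) T =
      ∑ u ∈ Tᶜ, x u (del u (ξ T)) +
      ∑ u ∈ Tᶜ, ∑ t ∈ T, ((-1 : K) ^ (T.filter (fun v => v < u)).card *
        (-1) ^ ((insert u T).filter (fun v => v < t)).card) •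
          x u (del t (ξ (insert u (T.erase t)))) := by
    rw [deRhamContraction, ← Finset.sum_add_distrib]
    refine Finset.sum_congr rfl fun u hu => ?_
    rw [Finset.mem_compl] at hu
    rw [cubeD_apply, Finset.sum_insert hu, map_add, smul_add, map_smul, smul_smul,
      Finset.erase_insert hu, Finset.filter_insert, if_neg (lt_irrefl u), ← mul_pow, neg_one_mul,
      neg_neg, one_pow, one_smul, map_sum, Finset.smul_sum]
    refine congrArg _ (Finset.sum_congr rfl fun t ht => ?_)
    rw [map_smul, smul_smul, Finset.erase_insert_of_ne (show u ≠ t from fun h => hu (h ▸ ht))]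
  have h3 : ∑ t ∈ T, ∑ u ∈ Tᶜ, ((-1 : K) ^ (T.filter (fun v => v < t)).card *
        (-1) ^ ((T.erase t).filter (fun v => v < u)).card) •
          x u (del t (ξ (insert u (T.erase t)))) =
      -∑ u ∈ Tᶜ, ∑ t ∈ T, ((-1 : K) ^ (T.filter (fun v => v < u)).card *
        (-1) ^ ((insert u T).filter (fun v => v < t)).card) •
          x u (del t (ξ (insert u (T.erase t)))) := by
    rw [Finset.sum_comm, ← Finset.sum_neg_distrib]
    refine Finset.sum_congr rfl fun u hu => ?_
    rw [← Finset.sum_neg_distrib]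
    refine Finset.sum_congr rfl fun t ht => ?_
    rw [neg_one_pow_card_filter_exchange ht (Finset.mem_compl.1 hu), neg_smul]
  -- The diagonal terms over `T` and over `Tᶜ` combine to the full sum over `i`.
  rw [h1, h2, h3, Finset.sum_add_distrib, ← Finset.sum_add_sum_compl T, Finset.sum_smul]
  abel

/-- The contraction is a nullhomotopy of the Lie derivative, so the cohomology vanishes in the
degrees where the Lie derivative acts by a nonzero scalar. -/
theorem cubeCohomologyPart_eq_bot_of_cartan (del x : Fin n → N →ₗ[K] N) (c : Fin n → K)
    (hne : ∀ t u, t ≠ u → ∀ z, del t (x u z) = x u (del t z))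
    (heq : ∀ t z, del t (x t z) = x t (del t z) + c t • z)
    (B : Finset (Fin n) → Submodule K N) (e : K) (he : e ≠ 0)
    (hB : ∀ T, ∀ z ∈ B T, ∑ i, x i (del i z) + (∑ t ∈ T, c t) • z = e • z) (q : ℕ) :
    cubeCohomologyPart (A := fun _ : Finset (Fin n) => N) (fun _ t => del t) q B = ⊥ := by
  rw [eq_bot_iff]
  rintro _ ⟨⟨ξ, hξq, hξ⟩, hξB, rfl⟩
  rw [Submodule.mem_bot, Submodule.mkQ_apply, Submodule.Quotient.mk_eq_zero]
  -- As `dξ = 0`, Cartan's formula reads `dιξ = e ξ`. For `q = 0` the contraction is `0`, so the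
  -- argument covers that case too.
  refine ⟨e⁻¹ • deRhamContraction x ξ, ?_, ?_⟩
  · intro S hS
    rw [Pi.smul_apply, deRhamContraction, Finset.sum_eq_zero, smul_zero]
    intro u hu
    rw [hξq, map_zero, smul_zero]
    change ¬(insert u S).card = q
    rwa [Finset.card_insert_of_notMem (Finset.mem_compl.1 hu)]
  · funext T
    have h := cartan_formula del x c hne heq ξ T
    have h0 : cubeD (A := fun _ => N) (fun _ t => del t) ξ = 0 := hξ
    have h1 : deRhamContraction x (0 : Finset (Fin n) → N) T = 0 := by simp [deRhamContraction]
    rw [h0, h1, add_zero] at h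
    replace h := h.trans (hB T _ (hξB T (Set.mem_univ T)))
    rw [map_smul, Pi.smul_apply, h, smul_smul, inv_mul_cancel₀ he, one_smul]
    rfl

end DeRham

/-! ### Concentration in degree `-ω`. -/

theorem theorem1 {K : Type*} [Field K] [CharZero K] {n : ℕ} (w : Fin n → ℕ) (hw : ∀ i, 0 < w i)
    (I : Ideal (MvPolynomial (Fin n) K))
    (hI : I.IsHomogeneous (MvPolynomial.weightedHomogeneousSubmodule K w))
    {s : ℕ} (f : Fin s → MvPolynomial (Fin n) K)
    (hf : ∀ j, ∃ d, MvPolynomial.IsWeightedHomogeneous w (f j) d)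
    (hfI : Ideal.span (Set.range f) = I) (p q : ℕ) :
    deRhamDegree w (fun i => localCohomologyDer f p (MvPolynomial.pderiv i))
        (localCohomologyDegree w f p) q (-∑ i, (w i : ℤ)) = ⊤ ∧
      ∀ j : ℤ, j ≠ -∑ i, (w i : ℤ) →
        deRhamDegree w (fun i => localCohomologyDer f p (MvPolynomial.pderiv i))
          (localCohomologyDegree w f p) q j = ⊥ := by
  classical
  -- The weights over `Tᶜ` come from the grading shift and those over `T` from the Lie derivative of
  -- `dX_T`; together they give an eigenvalue independent of `T`.
  have hE : ∀ (j : ℤ) (T : Finset (Fin n)),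
      ∀ z ∈ localCohomologyDegree w f p (j + ∑ i ∈ Tᶜ, (w i : ℤ)),
      localCohomologyDer f p (eulerDer K w) z + (∑ t ∈ T, (w t : K)) • z =
        (j + ∑ i, (w i : ℤ) : ℤ) • z := by
    intro j T z hz
    rw [localCohomologyDer_eulerDer_of_mem w f p _ hz, ← add_smul, ← Int.cast_smul_eq_zsmul K,
      ← Finset.sum_add_sum_compl T]
    push_cast
    congr 1
    ring
  have hbot : ∀ j : ℤ, j ≠ -∑ i, (w i : ℤ) →
      deRhamDegree w (fun i => localCohomologyDer f p (MvPolynomial.pderiv i))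
        (localCohomologyDegree w f p) q j = ⊥ := by
    intro j hj
    refine cubeCohomologyPart_eq_bot_of_cartan _
      (fun i => (w i : K) • localCohomologyMul f p (MvPolynomial.X i)) (fun i => (w i : K))
      ?_ ?_ _ ((j + ∑ i, (w i : ℤ) : ℤ) : K) ?_ ?_ q
    · intro t u htu z
      rw [LinearMap.smul_apply, LinearMap.smul_apply, map_smul, localCohomologyDer_mul,
        MvPolynomial.pderiv_X_of_ne htu.symm, localCohomologyMul_zero, zero_add]
    · intro t z
      rw [LinearMap.smul_apply, LinearMap.smul_apply, map_smul, localCohomologyDer_mul,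
        MvPolynomial.pderiv_X_self, localCohomologyMul_one, smul_add, add_comm]
    · rw [Int.cast_ne_zero]
      exact fun h => hj (eq_neg_of_add_eq_zero_left h)
    · intro T z hz
      rw [Int.cast_smul_eq_zsmul, ← hE j T z hz, localCohomologyDer_eulerDer]
      rfl
  refine ⟨?_, hbot⟩
  have htop : ⨆ j, deRhamDegree w (fun i => localCohomologyDer f p (MvPolynomial.pderiv i))
      (localCohomologyDegree w f p) q j = ⊤ := by
    refine iSup_cubeCohomologyPart (A := fun _ => LocalCohomology K f p) _
      (fun T => localCohomologyDer f p (eulerDer K w) +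
        (∑ t ∈ T, (w t : K)) • (LinearMap.id : LocalCohomology K f p →ₗ[K] _))
      ?_ _ (fun j => ((j + ∑ i, (w i : ℤ) : ℤ) : K))
      (Int.cast_injective.comp (add_left_injective _)) ?_ ?_ q
    · intro T t ht z
      simp only [LinearMap.add_apply, LinearMap.smul_apply, LinearMap.id_apply, map_add, map_smul]
      rw [localCohomologyDer_pderiv_eulerDer, add_assoc, ← add_smul, 
        Finset.add_sum_erase T (fun t => (w t : K)) ht]
    · intro j T z hz
      rw [Int.cast_smul_eq_zsmul]
      exact hE j T z hz
    · intro T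
      rw [← iSup_localCohomologyDegree w f p hf]
      -- For fixed `T` the grading shift only permutes the degrees.
      exact (Equiv.addRight (∑ i ∈ Tᶜ, (w i : ℤ))).iSup_comp (g := localCohomologyDegree w f p)
  rw [← htop]
  refine le_antisymm (le_iSup (fun j => deRhamDegree w _ (localCohomologyDegree w f p) q j) _)
    (iSup_le fun j => ?_)
  by_cases hj : j = -∑ i, (w i : ℤ)
  · rw [hj]
  · rw [hbot j hj]
    exact bot_le
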